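/- Let $n\ge 0$ be an integer, let $A,B$ be positive definite $n\times n$ complex (Hermitian) matrices, and let $r\ge 0$ and $t\in[0,1]$ be real. For real $s$ and a positive definite matrix $X$, let $X^s$ be defined by the functional calculus, and for $s\in[0,1]$ let $$A\sharp_s B = A^{1/2}\bigl(A^{-1/2}BA^{-1/2}\bigr)^{s}A^{1/2}$$ be the weighted geometric mean. For a complex matrix $X$ let $|X|=(X^*X)^{1/2}$ and $\|X\|_p=\bigl(\operatorname{Tr}|X|^p\bigr)^{1/p}$, so that $\|X\|_1$ is the trace norm and $\|X\|_2$ is the Frobenius norm. Then for $p=1$ and for $p=2$, $$\bigl\|A+B+r\,(A\sharp_t B+A\sharp_{1-t}B)\bigr\|_p\;\le\;\bigl\|A+B+r\,(A^{t}B^{1-t}+A^{1-t}B^{t})\bigr\|_p .$$ -/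

import Mathlib

open scoped MatrixOrder ComplexOrder

noncomputable section

namespace HeronMean

variable {ι : Type*} [Fintype ι] [DecidableEq ι]

/-- The weighted geometric mean `A ♯ₜ B = A^{1/2} (A^{-1/2} B A^{-1/2})^t A^{1/2}` of positive
definite complex matrices. Real powers are those of the continuous functional calculus. -/
def geomMean (t : ℝ) (A B : Matrix ι ι ℂ) : Matrix ι ι ℂ :=
  A ^ (1 / 2 : ℝ) * (A ^ (-(1 / 2) : ℝ) * B * A ^ (-(1 / 2) : ℝ)) ^ t * A ^ (1 / 2 : ℝ)

/-- The Schatten `p`-norm `‖X‖_p = (Tr |X|^p)^{1/p}`, where `|X| = (Xᴴ X)^{1/2}`. It is the trace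
norm for `p = 1` and the Frobenius norm for `p = 2`. -/
def schattenNorm (p : ℝ) (X : Matrix ι ι ℂ) : ℝ :=
  ((CFC.abs X ^ p).trace.re) ^ (1 / p)

end HeronMean

end

namespace HeronMean

open Matrix Finset

variable {ι : Type*} [Fintype ι] [DecidableEq ι] {A B C G M N X : Matrix ι ι ℂ}

/-! Put `C = A^{-1/2} B A^{-1/2}`. Everything rests on `re_trace_rpow_mul_rpow_le`. Taken with this
`C`, for which `A^{1/2} C A^{1/2} = B`, it gives `Tr (A ♯ₜ B) ≤ Tr A^{1-t} B^t` at `q = 0` and `Tr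
A² C^t ≤ Tr A^{2-t} B^t` at `q = 1`.

To prove it, write `x^t` as a positive integral over `s` of the kernels `x / (s + x)`. For one
kernel the left side is `Tr A^q G` with `G = (A⁻¹ + s B⁻¹)⁻¹`, and `re_trace_rpow_mul_le_sum` bounds
it by maximizing a quadratic entry by entry in the eigenbases of `A` and `B`.

For `p = 1` the left matrix is positive semidefinite, so its norm is its trace, and `Re Tr X ≤ ‖X‖₁`
handles the right side. For `p = 2` both squared norms are expanded and compared term by term: the
terms linear in `r` by the case `q = 1`, the squares by `q = 1` after a symmetrization in the
eigenbasis of `C`, the cross term `Tr (A ♯ₜ B)(A ♯_{1-t} B) ≤ Tr AB` by the weighted AM-GM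
inequality. -/

/-! ### Traces and intertwining relations in a pair of eigenbases. -/

/-- The matrix of `M` with respect to the eigenbases of the Hermitian matrices `A` and `B`. -/
noncomputable def mixedMatrix (hA : A.IsHermitian) (hB : B.IsHermitian) (M : Matrix ι ι ℂ) :
    Matrix ι ι ℂ :=
  (hA.eigenvectorUnitary : Matrix ι ι ℂ)ᴴ * M * (hB.eigenvectorUnitary : Matrix ι ι ℂ)

lemma cfc_eq_conj (hA : A.IsHermitian) (f : ℝ → ℝ) :
    cfc f A = (hA.eigenvectorUnitary : Matrix ι ι ℂ) *
      diagonal (fun i => ((f (hA.eigenvalues i) : ℝ) : ℂ)) *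
      (hA.eigenvectorUnitary : Matrix ι ι ℂ)ᴴ := by
  rw [hA.cfc_eq, IsHermitian.cfc, Unitary.conjStarAlgAut_apply]
  rfl

lemma eigenvectorUnitary_conjTranspose_mul (hA : A.IsHermitian) :
    (hA.eigenvectorUnitary : Matrix ι ι ℂ)ᴴ * (hA.eigenvectorUnitary : Matrix ι ι ℂ) = 1 :=
  Unitary.coe_star_mul_self hA.eigenvectorUnitary

lemma eigenvectorUnitary_mul_conjTranspose (hA : A.IsHermitian) :
    (hA.eigenvectorUnitary : Matrix ι ι ℂ) * (hA.eigenvectorUnitary : Matrix ι ι ℂ)ᴴ = 1 :=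
  Unitary.coe_mul_star_self hA.eigenvectorUnitary

lemma mixedMatrix_cfc_mul (hA : A.IsHermitian) (hB : B.IsHermitian) (f : ℝ → ℝ) (i j : ι) :
    mixedMatrix hA hB (cfc f A * M) i j = f (hA.eigenvalues i) * mixedMatrix hA hB M i j := by
  have h : mixedMatrix hA hB (cfc f A * M) =
      diagonal (fun i => ((f (hA.eigenvalues i) : ℝ) : ℂ)) * mixedMatrix hA hB M := by
    rw [cfc_eq_conj hA, mixedMatrix, mixedMatrix]
    simp only [← mul_assoc, eigenvectorUnitary_conjTranspose_mul, one_mul]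
  rw [h, diagonal_mul]

lemma mixedMatrix_mul_cfc (hA : A.IsHermitian) (hB : B.IsHermitian) (f : ℝ → ℝ) (i j : ι) :
    mixedMatrix hA hB (M * cfc f B) i j = f (hB.eigenvalues j) * mixedMatrix hA hB M i j := by
  have h : mixedMatrix hA hB (M * cfc f B) =
      mixedMatrix hA hB M * diagonal (fun i => ((f (hB.eigenvalues i) : ℝ) : ℂ)) := by
    rw [cfc_eq_conj hB, mixedMatrix, mixedMatrix]
    simp only [mul_assoc, eigenvectorUnitary_conjTranspose_mul, mul_one]
  rw [h, mul_diagonal, mul_comm]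

lemma mixedMatrix_injective (hA : A.IsHermitian) (hB : B.IsHermitian) :
    Function.Injective (mixedMatrix hA hB) := by
  intro M N h
  have key : ∀ X : Matrix ι ι ℂ, (hA.eigenvectorUnitary : Matrix ι ι ℂ) * mixedMatrix hA hB X *
      (hB.eigenvectorUnitary : Matrix ι ι ℂ)ᴴ = X := fun X => by
    rw [mixedMatrix, mul_assoc, mul_assoc, eigenvectorUnitary_mul_conjTranspose, mul_one,
      ← mul_assoc, eigenvectorUnitary_mul_conjTranspose, one_mul]
  rw [← key M, h, key N]

lemma mixedMatrix_swap (hA : A.IsHermitian) (hM : M.IsHermitian) (i j : ι) :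
    mixedMatrix hA hA M j i = star (mixedMatrix hA hA M i j) := by
  have h : (mixedMatrix hA hA M).IsHermitian := isHermitian_conjTranspose_mul_mul _ hM
  exact (h.apply j i).symm

lemma trace_mul_conjTranspose_eq_sum (hA : A.IsHermitian) (hB : B.IsHermitian) :
    (M * Nᴴ).trace = ∑ i, ∑ j, mixedMatrix hA hB M i j * star (mixedMatrix hA hB N i j) := by
  have h : (mixedMatrix hA hB M * (mixedMatrix hA hB N)ᴴ).trace = (M * Nᴴ).trace := by
    have : mixedMatrix hA hB M * (mixedMatrix hA hB N)ᴴ =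
        (hA.eigenvectorUnitary : Matrix ι ι ℂ)ᴴ * (M * Nᴴ * hA.eigenvectorUnitary) := by
      simp only [mixedMatrix, conjTranspose_mul, conjTranspose_conjTranspose]
      simp only [mul_assoc]
      rw [← mul_assoc (hB.eigenvectorUnitary : Matrix ι ι ℂ) _ᴴ,
        eigenvectorUnitary_mul_conjTranspose, one_mul]
    rw [this, trace_mul_comm, mul_assoc, eigenvectorUnitary_mul_conjTranspose, mul_one]
  rw [← h]
  simp [trace, mul_apply]

lemma trace_cfc_mul_cfc_mul (hA : A.IsHermitian) (hB : B.IsHermitian) (f g : ℝ → ℝ) :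
    (cfc f A * M * cfc g B * Nᴴ).trace = ∑ i, ∑ j, (f (hA.eigenvalues i) : ℂ) *
      g (hB.eigenvalues j) * (mixedMatrix hA hB M i j * star (mixedMatrix hA hB N i j)) := by
  rw [trace_mul_conjTranspose_eq_sum hA hB]
  refine sum_congr rfl fun i _ => sum_congr rfl fun j _ => ?_
  rw [mixedMatrix_mul_cfc, mixedMatrix_cfc_mul]
  ring

lemma re_trace_cfc_mul_cfc_mul (hA : A.IsHermitian) (hB : B.IsHermitian) (f g : ℝ → ℝ) :
    (cfc f A * M * cfc g B * Mᴴ).trace.re = ∑ i, ∑ j, f (hA.eigenvalues i) *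
      g (hB.eigenvalues j) * Complex.normSq (mixedMatrix hA hB M i j) := by
  rw [trace_cfc_mul_cfc_mul hA hB, Complex.re_sum]
  refine sum_congr rfl fun i _ => ?_
  rw [Complex.re_sum]
  refine sum_congr rfl fun j _ => ?_
  rw [Complex.star_def, Complex.mul_conj]
  norm_cast

lemma sum_mul_le_sum_mul_of_symm {κ : Type*} [Fintype κ] {w h k : κ → κ → ℝ} (hw : ∀ i j, 0 ≤ w i j)
    (hsymm : ∀ i j, w j i = w i j) (hhk : ∀ i j, h i j + h j i ≤ k i j + k j i) :
    ∑ i, ∑ j, h i j * w i j ≤ ∑ i, ∑ j, k i j * w i j := by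
  have key : ∀ u : κ → κ → ℝ,
      2 * ∑ i, ∑ j, u i j * w i j = ∑ i, ∑ j, (u i j + u j i) * w i j := fun u => by
    simp only [add_mul, sum_add_distrib]
    rw [two_mul, add_right_inj, sum_comm]
    simp only [hsymm]
  have := sum_le_sum fun i (_ : i ∈ univ) => sum_le_sum fun j (_ : j ∈ univ) =>
    mul_le_mul_of_nonneg_right (hhk i j) (hw i j)
  rw [← key, ← key] at this
  linarith

/-- Weighted sums of the form `Tr f(A) M g(A) M` with `M` Hermitian are compared through the
symmetrization of the weights. -/
lemma re_trace_cfc_le_of_symm (hA : A.IsHermitian) (hM : M.IsHermitian) {f g f' g' : ℝ → ℝ}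
    (h : ∀ i j, f (hA.eigenvalues i) * g (hA.eigenvalues j) +
        f (hA.eigenvalues j) * g (hA.eigenvalues i) ≤
      f' (hA.eigenvalues i) * g' (hA.eigenvalues j) +
        f' (hA.eigenvalues j) * g' (hA.eigenvalues i)) :
    (cfc f A * M * cfc g A * M).trace.re ≤ (cfc f' A * M * cfc g' A * M).trace.re := by
  have e := re_trace_cfc_mul_cfc_mul (M := M) hA hA f g
  have e' := re_trace_cfc_mul_cfc_mul (M := M) hA hA f' g'
  rw [hM.eq] at e e'
  rw [e, e']
  refine sum_mul_le_sum_mul_of_symm (fun i j => Complex.normSq_nonneg _) (fun i j => ?_) h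
  rw [mixedMatrix_swap hA hM, Complex.star_def, Complex.normSq_conj]

/-- The intertwining relation forces an entry of the mixed matrix of `M` to vanish unless `f` and
`g` agree at the corresponding pair of eigenvalues; only those pairs matter for `f'` and `g'`. -/
lemma cfc_mul_eq_mul_cfc (hA : A.IsHermitian) (hB : B.IsHermitian) {f g f' g' : ℝ → ℝ}
    (h : cfc f A * M = M * cfc g B)
    (hfg : ∀ i j, f (hA.eigenvalues i) = g (hB.eigenvalues j) →
      f' (hA.eigenvalues i) = g' (hB.eigenvalues j)) :
    cfc f' A * M = M * cfc g' B := by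
  apply mixedMatrix_injective hA hB
  ext i j
  have e := congr_fun₂ (congr_arg (mixedMatrix hA hB) h) i j
  rw [mixedMatrix_cfc_mul, mixedMatrix_mul_cfc] at e ⊢
  rcases eq_or_ne (mixedMatrix hA hB M i j) 0 with h0 | h0
  · simp [h0]
  · rw [hfg i j (by exact_mod_cast mul_right_cancel₀ h0 e)]

/-! ### Real powers of positive definite matrices. -/

lemma rpow_eq_cfc (hA : A.PosDef) (s : ℝ) : A ^ s = cfc (fun x : ℝ => x ^ s) A :=
  CFC.rpow_eq_cfc_real hA.posSemidef.nonneg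

lemma isHermitian_cfc (f : ℝ → ℝ) (A : Matrix ι ι ℂ) : (cfc f A).IsHermitian :=
  cfc_predicate f A

lemma cfc_one_eq_one (hA : A.IsHermitian) : cfc (fun _ : ℝ => (1 : ℝ)) A = 1 :=
  cfc_const_one ℝ A hA

lemma isHermitian_rpow (A : Matrix ι ι ℂ) (s : ℝ) : (A ^ s).IsHermitian :=
  (CFC.rpow_nonneg (a := A) (y := s)).posSemidef.1

lemma posDef_rpow (hA : A.PosDef) (s : ℝ) : (A ^ s).PosDef :=
  ((CFC.rpow_nonneg (a := A) (y := s)).posSemidef.posDef_iff_isUnit).2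
    (hA.isUnit.cfcRpow s hA.posSemidef.nonneg)

lemma rpow_mul_rpow (hA : A.PosDef) (s t : ℝ) : A ^ s * A ^ t = A ^ (s + t) :=
  (CFC.rpow_add hA.isUnit).symm

lemma rpow_mul_rpow_mul (hA : A.PosDef) (s t : ℝ) (M : Matrix ι ι ℂ) :
    A ^ s * (A ^ t * M) = A ^ (s + t) * M := by
  rw [← mul_assoc, rpow_mul_rpow hA]

lemma rpow_zero' (hA : A.PosDef) : A ^ (0 : ℝ) = 1 := CFC.rpow_zero A hA.posSemidef.nonneg

lemma rpow_one' (hA : A.PosDef) : A ^ (1 : ℝ) = A := CFC.rpow_one A hA.posSemidef.nonneg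

lemma posDef_conj (hA : A.PosDef) (hC : C.PosDef) (s : ℝ) : (A ^ s * C * A ^ s).PosDef := by
  have hu : IsUnit (A ^ s) := (posDef_rpow hA s).isUnit
  have h := hC.posSemidef.conjTranspose_mul_mul_same (A ^ s)
  rw [(isHermitian_rpow A s).eq] at h
  exact h.posDef_iff_isUnit.2 ((hu.mul hC.isUnit).mul hu)

/-! ### The main trace inequality. -/

/-- For `0 < t < 1`, `x^t` is a positive multiple of `∫ s^{t-1} x / (s + x) ds` over `s > 0`, so a
comparison for every kernel integrates to one for the power. The weights may have any sign. -/
lemma sum_mul_rpow_le_sum_mul_rpow {κ : Type*} [Fintype κ] {w x m y : κ → ℝ} {t : ℝ}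
    (ht : t ∈ Set.Ioo (0 : ℝ) 1) (hx : ∀ i, 0 ≤ x i) (hy : ∀ i, 0 ≤ y i)
    (h : ∀ s : ℝ, 0 < s → ∑ i, w i * (x i / (s + x i)) ≤ ∑ i, m i * (y i / (s + y i))) :
    ∑ i, w i * x i ^ t ≤ ∑ i, m i * y i ^ t := by
  have key : ∀ v z : κ → ℝ, (∀ i, 0 ≤ z i) →
      ∑ i, v i * z i ^ t = (∫ s in Set.Ioi 0, Real.rpowIntegrand₀₁ t s 1)⁻¹ *
        ∫ s in Set.Ioi 0, ∑ i, v i * Real.rpowIntegrand₀₁ t s (z i) := by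
    intro v z hz
    rw [MeasureTheory.integral_finsetSum _ fun i _ =>
      (Real.integrableOn_rpowIntegrand₀₁_Ioi ht (hz i)).const_mul _, mul_sum]
    refine sum_congr rfl fun i _ => ?_
    rw [MeasureTheory.integral_const_mul, Real.rpow_eq_const_mul_integral ht (hz i)]
    ring
  have key' : ∀ v z : κ → ℝ, (∀ i, 0 ≤ z i) →
      MeasureTheory.IntegrableOn (fun s => ∑ i, v i * Real.rpowIntegrand₀₁ t s (z i))
        (Set.Ioi 0) := fun v z hz => MeasureTheory.integrable_finsetSum _ fun i _ =>
      (Real.integrableOn_rpowIntegrand₀₁_Ioi ht (hz i)).const_mul _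
  rw [key w x hx, key m y hy]
  refine mul_le_mul_of_nonneg_left ?_ (inv_nonneg.2 (Real.integral_rpowIntegrand₀₁_one_pos ht).le)
  refine MeasureTheory.setIntegral_mono_on (key' w x hx) (key' m y hy) measurableSet_Ioi ?_
  intro s hs
  have hs' : (0 : ℝ) < s := hs
  have e : ∀ v z : κ → ℝ, (∀ i, 0 ≤ z i) →
      ∑ i, v i * Real.rpowIntegrand₀₁ t s (z i) =
        s ^ (t - 1) * ∑ i, v i * (z i / (s + z i)) := fun v z hz => by
    rw [mul_sum]
    refine sum_congr rfl fun i _ => ?_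
    rw [Real.rpowIntegrand₀₁_eq_pow_div ht hs'.le (hz i)]
    ring
  rw [e w x hx, e m y hy]
  exact mul_le_mul_of_nonneg_left (h s hs') (Real.rpow_nonneg hs'.le _)

lemma two_mul_re_sub_le {a b s : ℝ} (ha : 0 < a) (hb : 0 < b) (hs : 0 < s) (x y : ℂ) :
    2 * (y * star x).re - Complex.normSq y * (a⁻¹ + s * b⁻¹) ≤
      b / a / (s + b / a) * a * Complex.normSq x := by
  have hd : 0 < a⁻¹ + s * b⁻¹ := by positivity
  have e : b / a / (s + b / a) * a = (a⁻¹ + s * b⁻¹)⁻¹ := by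
    field_simp
    ring
  rw [e]
  generalize a⁻¹ + s * b⁻¹ = d at hd
  -- With `d = a⁻¹ + s b⁻¹`, completing the square gives `2 Re (y x̄) - d |y|² ≤ |x|² / d`.
  have h := Complex.normSq_nonneg ((d : ℂ) * y - x)
  have e2 : Complex.normSq ((d : ℂ) * y - x) =
      d * (d * Complex.normSq y - 2 * (y * star x).re + d⁻¹ * Complex.normSq x) := by
    rw [Complex.normSq_sub, Complex.normSq_mul, Complex.normSq_ofReal, mul_assoc (d : ℂ),
      Complex.re_ofReal_mul, Complex.star_def]
    linear_combination (-Complex.normSq x) * mul_inv_cancel₀ hd.ne'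
  rw [e2] at h
  have := nonneg_of_mul_nonneg_right h hd
  linarith

/-- The hypothesis `hGAB` is the equation satisfied by `(A⁻¹ + s B⁻¹)⁻¹`. It allows `Tr A^q G` to be
rewritten as twice itself minus terms quadratic in `G`, which are not diagonal in the mixed
eigenbasis until `A^q G A⁻¹ G` is replaced by `A^{q-1} G G`. -/
lemma re_trace_rpow_mul_le_sum (hA : A.PosDef) (hB : B.PosDef) (hG : G.IsHermitian) {s q : ℝ}
    (hs : 0 < s) (hq : 0 ≤ q)
    (hGAB : G * A ^ (-1 : ℝ) * G + s • (G * B ^ (-1 : ℝ) * G) = G) :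
    (A ^ q * G).trace.re ≤ ∑ i, ∑ j, hA.1.eigenvalues i ^ (q + 1) *
      Complex.normSq (mixedMatrix hA.1 hB.1 1 i j) *
      (hB.1.eigenvalues j / hA.1.eigenvalues i /
        (s + hB.1.eigenvalues j / hA.1.eigenvalues i)) := by
  have e1 : (A ^ q * G).trace.re = ∑ i, ∑ j, hA.1.eigenvalues i ^ q *
      (mixedMatrix hA.1 hB.1 G i j * star (mixedMatrix hA.1 hB.1 1 i j)).re := by
    have := congr_arg Complex.re
      (trace_cfc_mul_cfc_mul (M := G) (N := 1) hA.1 hB.1 (fun x => x ^ q) (fun _ => 1))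
    rw [cfc_one_eq_one hB.1, conjTranspose_one, mul_one, mul_one, ← rpow_eq_cfc hA] at this
    rw [this, Complex.re_sum]
    refine sum_congr rfl fun i _ => ?_
    rw [Complex.re_sum]
    refine sum_congr rfl fun j _ => ?_
    rw [Complex.ofReal_one, mul_one, Complex.re_ofReal_mul]
  have e2 : (A ^ (q - 1) * G * G).trace.re = ∑ i, ∑ j, hA.1.eigenvalues i ^ (q - 1) *
      Complex.normSq (mixedMatrix hA.1 hB.1 G i j) := by
    have := re_trace_cfc_mul_cfc_mul (M := G) hA.1 hB.1 (fun x => x ^ (q - 1)) (fun _ => 1)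
    rw [cfc_one_eq_one hB.1, hG.eq, mul_one, ← rpow_eq_cfc hA] at this
    simpa using this
  have e3 : (A ^ q * G * B ^ (-1 : ℝ) * G).trace.re = ∑ i, ∑ j, hA.1.eigenvalues i ^ q *
      (hB.1.eigenvalues j)⁻¹ * Complex.normSq (mixedMatrix hA.1 hB.1 G i j) := by
    have := re_trace_cfc_mul_cfc_mul (M := G) hA.1 hB.1 (fun x => x ^ q) (fun x => x ^ (-1 : ℝ))
    rw [hG.eq, ← rpow_eq_cfc hA, ← rpow_eq_cfc hB] at this
    simpa [Real.rpow_neg_one] using this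
  have h4 : (A ^ (q - 1) * G * G).trace.re ≤ (A ^ q * G * A ^ (-1 : ℝ) * G).trace.re := by
    have := re_trace_cfc_le_of_symm hA.1 hG (f := fun x => x ^ (q - 1)) (g := fun _ => 1)
      (f' := fun x => x ^ q) (g' := fun x => x ^ (-1 : ℝ)) fun i j => by
        have hi := hA.eigenvalues_pos i
        have hj := hA.eigenvalues_pos j
        simp only [Real.rpow_neg_one, mul_one, Real.rpow_sub hi, Real.rpow_sub hj, Real.rpow_one]
        generalize hA.1.eigenvalues i = a at hi
        generalize hA.1.eigenvalues j = b at hj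
        -- Here `q ≥ 0` is essential: `x ↦ x^q` and `x ↦ x` are then ordered the same way.
        have hmono : 0 ≤ (a ^ q - b ^ q) * (a - b) := by
          rcases le_total a b with hab | hab
          · exact mul_nonneg_of_nonpos_of_nonpos
              (sub_nonpos.2 (Real.rpow_le_rpow hi.le hab hq)) (sub_nonpos.2 hab)
          · exact mul_nonneg (sub_nonneg.2 (Real.rpow_le_rpow hj.le hab hq)) (sub_nonneg.2 hab)
        have : a ^ q * b⁻¹ + b ^ q * a⁻¹ - (a ^ q / a + b ^ q / b) =
            (a ^ q - b ^ q) * (a - b) / (a * b) := by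
          field_simp
          ring
        have h' : 0 ≤ (a ^ q - b ^ q) * (a - b) / (a * b) := by positivity
        linarith
    rwa [cfc_one_eq_one hA.1, mul_one, ← rpow_eq_cfc hA, ← rpow_eq_cfc hA, ← rpow_eq_cfc hA] at this
  have h5 : (A ^ q * G).trace.re = (A ^ q * G * A ^ (-1 : ℝ) * G).trace.re +
      s * (A ^ q * G * B ^ (-1 : ℝ) * G).trace.re := by
    conv_lhs => rw [← hGAB]
    rw [mul_add, trace_add, Complex.add_re, mul_smul_comm, trace_smul, Complex.smul_re,
      smul_eq_mul]
    simp only [mul_assoc]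
  have h6 : 2 * (A ^ q * G).trace.re - (A ^ (q - 1) * G * G).trace.re -
      s * (A ^ q * G * B ^ (-1 : ℝ) * G).trace.re ≤ ∑ i, ∑ j, hA.1.eigenvalues i ^ (q + 1) *
      Complex.normSq (mixedMatrix hA.1 hB.1 1 i j) *
      (hB.1.eigenvalues j / hA.1.eigenvalues i /
        (s + hB.1.eigenvalues j / hA.1.eigenvalues i)) := by
    rw [e1, e2, e3]
    simp only [mul_sum, ← sum_sub_distrib]
    refine sum_le_sum fun i _ => sum_le_sum fun j _ => ?_
    have hi := hA.eigenvalues_pos i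
    have h := mul_le_mul_of_nonneg_left
      (two_mul_re_sub_le hi (hB.eigenvalues_pos j) hs (mixedMatrix hA.1 hB.1 1 i j)
        (mixedMatrix hA.1 hB.1 G i j)) (Real.rpow_nonneg hi.le q)
    rw [Real.rpow_sub hi, Real.rpow_add hi, Real.rpow_one, div_eq_mul_inv]
    linarith
  linarith

lemma rpow_neg_one_eq_of_mul_eq_one (hA : A.PosDef) (h : A * M = 1) : A ^ (-1 : ℝ) = M := by
  have h1 : A ^ (-1 : ℝ) * A = 1 := by
    have := rpow_mul_rpow hA (-1) 1
    rwa [rpow_one' hA, neg_add_cancel, rpow_zero' hA] at this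
  rw [← mul_one (A ^ (-1 : ℝ)), ← h, ← mul_assoc, h1, one_mul]

lemma mul_rpow_neg_one (hA : A.PosDef) : A * A ^ (-1 : ℝ) = 1 := by
  have h := rpow_mul_rpow hA 1 (-1)
  rwa [rpow_one' hA, add_neg_cancel, rpow_zero' hA] at h

/-- Petz-type versus maximal divergence: `Tr A^{1+q} C^t ≤ Tr A^{q+1-t} (A^{1/2} C A^{1/2})^t`. -/
theorem re_trace_rpow_mul_rpow_le (hA : A.PosDef) (hC : C.PosDef) {q t : ℝ} (hq : 0 ≤ q)
    (ht : t ∈ Set.Icc (0 : ℝ) 1) :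
    (A ^ (q + 1) * C ^ t).trace.re ≤
      (A ^ (q + 1 - t) * (A ^ (1 / 2 : ℝ) * C * A ^ (1 / 2 : ℝ)) ^ t).trace.re := by
  have hB : (A ^ (1 / 2 : ℝ) * C * A ^ (1 / 2 : ℝ)).PosDef := posDef_conj hA hC _
  -- At `t = 0` and `t = 1` equality holds; the integral representation needs `t` in the open
  -- interval.
  rcases ht.1.eq_or_lt with rfl | h0
  · rw [rpow_zero' hC, rpow_zero' hB, sub_zero]
  rcases ht.2.eq_or_lt with rfl | h1
  · rw [rpow_one' hC, rpow_one' hB, add_sub_cancel_right, mul_assoc, rpow_mul_rpow_mul hA,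
      ← mul_assoc, trace_mul_comm (_ * C), rpow_mul_rpow_mul hA,
      show 1 / 2 + (q + 1 / 2) = q + 1 by ring]
  have eC : ∀ g : ℝ → ℝ, (A ^ (q + 1) * cfc g C).trace.re =
      ∑ k : ι × ι, hA.1.eigenvalues k.1 ^ (q + 1) *
        Complex.normSq (mixedMatrix hA.1 hC.1 1 k.1 k.2) * g (hC.1.eigenvalues k.2) := fun g => by
    have := re_trace_cfc_mul_cfc_mul (M := 1) hA.1 hC.1 (fun x => x ^ (q + 1)) g
    rw [conjTranspose_one, mul_one, mul_one, ← rpow_eq_cfc hA] at this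
    rw [this, Fintype.sum_prod_type]
    exact sum_congr rfl fun i _ => sum_congr rfl fun j _ => by ring
  -- Since `a^{q+1-t} b^t = a^{q+1} (b/a)^t`, the right side is also a weighted sum of `t`-th
  -- powers, now of eigenvalue ratios.
  have eB : (A ^ (q + 1 - t) * (A ^ (1 / 2 : ℝ) * C * A ^ (1 / 2 : ℝ)) ^ t).trace.re =
      ∑ k : ι × ι, hA.1.eigenvalues k.1 ^ (q + 1) *
        Complex.normSq (mixedMatrix hA.1 hB.1 1 k.1 k.2) *
          (hB.1.eigenvalues k.2 / hA.1.eigenvalues k.1) ^ t := by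
    have := re_trace_cfc_mul_cfc_mul (M := 1) hA.1 hB.1 (fun x => x ^ (q + 1 - t)) (fun x => x ^ t)
    rw [conjTranspose_one, mul_one, mul_one, ← rpow_eq_cfc hA, ← rpow_eq_cfc hB] at this
    rw [this, Fintype.sum_prod_type]
    refine sum_congr rfl fun i _ => sum_congr rfl fun j _ => ?_
    have hi := hA.eigenvalues_pos i
    have hj := hB.eigenvalues_pos j
    rw [Real.div_rpow hj.le hi.le, Real.rpow_sub hi]
    ring
  rw [eB, rpow_eq_cfc hC, eC]
  refine sum_mul_rpow_le_sum_mul_rpow ⟨h0, h1⟩ (fun k => (hC.eigenvalues_pos _).le)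
    (fun k => div_nonneg (hB.eigenvalues_pos _).le (hA.eigenvalues_pos _).le) fun s hs => ?_
  rw [← eC fun x => x / (s + x)]
  set R := cfc (fun x : ℝ => x / (s + x)) C with hR
  -- The scalar identity `ρ² (1 + s/x) = ρ` for `ρ = x/(s+x)`; conjugating by `A^{1/2}` turns it
  -- into the equation required of `G = A^{1/2} R A^{1/2}`.
  have hRC : R * R + s • (R * C ^ (-1 : ℝ) * R) = R := by
    have hcont : ∀ f : ℝ → ℝ, ContinuousOn f (spectrum ℝ C) := fun f => by
      have : (spectrum ℝ C).Finite := by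
        rw [hC.1.spectrum_real_eq_range_eigenvalues]
        exact Set.finite_range _
      exact this.continuousOn f
    have hpos : ∀ x ∈ spectrum ℝ C, 0 < x := fun x hx => by
      rw [hC.1.spectrum_real_eq_range_eigenvalues] at hx
      obtain ⟨i, rfl⟩ := hx
      exact hC.eigenvalues_pos i
    rw [rpow_eq_cfc hC, hR, ← cfc_mul _ _ C (hcont _) (hcont _),
      ← cfc_mul _ _ C (hcont _) (hcont _), ← cfc_mul _ _ C (hcont _) (hcont _),
      ← cfc_smul _ _ C (hcont _), ← cfc_add C _ _ (hcont _) (hcont _)]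
    refine cfc_congr fun x hx => ?_
    have := hpos x hx
    have h2 : s + x ≠ 0 := by positivity
    simp only [Real.rpow_neg_one, smul_eq_mul]
    field_simp
    ring
  have hRh : R.IsHermitian := isHermitian_cfc _ _
  have hG : (A ^ (1 / 2 : ℝ) * R * A ^ (1 / 2 : ℝ)).IsHermitian := by
    have := isHermitian_conjTranspose_mul_mul (A ^ (1 / 2 : ℝ)) hRh
    rwa [(isHermitian_rpow A _).eq] at this
  set H := A ^ (1 / 2 : ℝ) with hH
  set K := A ^ (-(1 / 2) : ℝ) with hK
  have hHK : H * K = 1 := by rw [hH, hK, rpow_mul_rpow hA, add_neg_cancel, rpow_zero' hA]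
  have hKH : K * H = 1 := by rw [hH, hK, rpow_mul_rpow hA, neg_add_cancel, rpow_zero' hA]
  have hHK' : ∀ X, H * (K * X) = X := fun X => by rw [← mul_assoc, hHK, one_mul]
  have hKH' : ∀ X, K * (H * X) = X := fun X => by rw [← mul_assoc, hKH, one_mul]
  have hBinv : (H * C * H) ^ (-1 : ℝ) = K * C ^ (-1 : ℝ) * K := by
    apply rpow_neg_one_eq_of_mul_eq_one hB
    simp only [mul_assoc, hHK']
    rw [← mul_assoc C, mul_rpow_neg_one hC, one_mul, hHK]
  have hAinv : A ^ (-1 : ℝ) = K * K := by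
    rw [hK, rpow_mul_rpow hA]
    norm_num
  have key := re_trace_rpow_mul_le_sum hA hB hG hs hq (by
    rw [hBinv, hAinv]
    conv_rhs => rw [← hRC]
    simp only [mul_assoc, hHK', hKH', mul_add, add_mul, mul_smul_comm, smul_mul_assoc])
  rw [Fintype.sum_prod_type]
  convert key using 1
  rw [← mul_assoc, trace_mul_comm _ H, ← mul_assoc (A ^ q), ← mul_assoc, hH, rpow_mul_rpow hA,
    rpow_mul_rpow hA, show 1 / 2 + (q + 1 / 2) = q + 1 by ring]

/-! ### The weighted geometric mean and its symmetry. -/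

lemma rpow_half_mul_rpow_half (hA : A.PosDef) : A ^ (1 / 2 : ℝ) * A ^ (1 / 2 : ℝ) = A := by
  rw [rpow_mul_rpow hA, add_halves, rpow_one' hA]

lemma rpow_half_mul_rpow_neg_half (hA : A.PosDef) :
    A ^ (1 / 2 : ℝ) * A ^ (-(1 / 2) : ℝ) = 1 := by
  rw [rpow_mul_rpow hA, add_neg_cancel, rpow_zero' hA]

lemma rpow_neg_half_mul_rpow_half (hA : A.PosDef) :
    A ^ (-(1 / 2) : ℝ) * A ^ (1 / 2 : ℝ) = 1 := by
  rw [rpow_mul_rpow hA, neg_add_cancel, rpow_zero' hA]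

lemma rpow_half_conj_rpow_neg_half_conj (hA : A.PosDef) (B : Matrix ι ι ℂ) :
    A ^ (1 / 2 : ℝ) * (A ^ (-(1 / 2) : ℝ) * B * A ^ (-(1 / 2) : ℝ)) * A ^ (1 / 2 : ℝ) = B := by
  simp only [mul_assoc]
  rw [rpow_neg_half_mul_rpow_half hA, mul_one, ← mul_assoc, rpow_half_mul_rpow_neg_half hA,
    one_mul]

lemma geomMean_posDef (hA : A.PosDef) (hB : B.PosDef) (t : ℝ) : (geomMean t A B).PosDef :=
  posDef_conj hA (posDef_rpow (posDef_conj hA hB _) t) _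

lemma geomMean_comm (hA : A.PosDef) (hB : B.PosDef) (t : ℝ) :
    geomMean t A B = geomMean (1 - t) B A := by
  have hC : (A ^ (-(1 / 2) : ℝ) * B * A ^ (-(1 / 2) : ℝ)).PosDef := posDef_conj hA hB _
  have hD : (B ^ (-(1 / 2) : ℝ) * A * B ^ (-(1 / 2) : ℝ)).PosDef := posDef_conj hB hA _
  have hAA := rpow_half_mul_rpow_half hA
  have hHK := rpow_half_mul_rpow_neg_half hA
  have hKH := rpow_neg_half_mul_rpow_half hA
  have hB' : B ^ (-(1 / 2) : ℝ) * B ^ (-(1 / 2) : ℝ) = B ^ (-1 : ℝ) := by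
    rw [rpow_mul_rpow hB]
    norm_num
  have hBB := rpow_half_mul_rpow_half hB
  have hLK := rpow_half_mul_rpow_neg_half hB
  have hKL := rpow_neg_half_mul_rpow_half hB
  have hCB := rpow_half_conj_rpow_neg_half_conj hA B
  unfold geomMean
  set H := A ^ (1 / 2 : ℝ)
  set K := A ^ (-(1 / 2) : ℝ)
  set L := B ^ (1 / 2 : ℝ)
  set J := B ^ (-(1 / 2) : ℝ)
  have hKH' : ∀ X, K * (H * X) = X := fun X => by rw [← mul_assoc, hKH, one_mul]
  have hBinv : ∀ X, B * (B ^ (-1 : ℝ) * X) = X := fun X => by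
    rw [← mul_assoc, mul_rpow_neg_one hB, one_mul]
  have hCinv : (K * B * K) ^ (-1 : ℝ) = H * B ^ (-1 : ℝ) * H := by
    apply rpow_neg_one_eq_of_mul_eq_one hC
    simp only [mul_assoc, hKH', hBinv, hKH]
  -- `A^{1/2} B^{-1/2}` intertwines the inverse of `A^{-1/2} B A^{-1/2}` with `B^{-1/2} A B^{-1/2}`,
  -- hence also their powers of exponent `1 - t`.
  have hint : cfc (fun x : ℝ => x ^ (-1 : ℝ)) (K * B * K) * (H * J) =
      (H * J) * cfc (fun x : ℝ => x ^ (1 : ℝ)) (J * A * J) := by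
    rw [← rpow_eq_cfc hC, ← rpow_eq_cfc hD, rpow_one' hD, hCinv, ← hB', ← hAA]
    simp only [mul_assoc]
  have h := cfc_mul_eq_mul_cfc hC.1 hD.1 hint (f' := fun x : ℝ => x ^ (-(1 - t)))
    (g' := fun x : ℝ => x ^ (1 - t)) fun i j hij => by
      have hi := (hC.eigenvalues_pos i).le
      rw [Real.rpow_one, Real.rpow_neg_one] at hij
      rw [← hij, Real.inv_rpow hi, Real.rpow_neg hi]
  rw [← rpow_eq_cfc hC, ← rpow_eq_cfc hD] at h
  have hL : L = B * J := by rw [← hBB, mul_assoc, hLK, mul_one]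
  have e1 : L * (J * A * J) ^ (1 - t) = H * (K * B * K) * ((H * J) * (J * A * J) ^ (1 - t)) := by
    conv_lhs => rw [hL, ← hCB]
    simp only [mul_assoc]
  have e2 : K * B * K * (K * B * K) ^ (-(1 - t)) = (K * B * K) ^ t := by
    have := rpow_mul_rpow hC 1 (-(1 - t))
    rwa [rpow_one' hC, show 1 + -(1 - t) = t by ring] at this
  rw [e1, ← h, ← e2]
  simp only [mul_assoc, hKL, mul_one]

/-! ### Trace inequalities for geometric means. -/

lemma trace_geomMean_mul_geomMean (hA : A.PosDef) (B : Matrix ι ι ℂ) (s t : ℝ) :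
    (geomMean s A B * geomMean t A B).trace =
      ((A ^ (-(1 / 2) : ℝ) * B * A ^ (-(1 / 2) : ℝ)) ^ s * A *
        (A ^ (-(1 / 2) : ℝ) * B * A ^ (-(1 / 2) : ℝ)) ^ t * A).trace := by
  unfold geomMean
  generalize A ^ (-(1 / 2) : ℝ) * B * A ^ (-(1 / 2) : ℝ) = C
  have hAA := rpow_half_mul_rpow_half hA
  generalize A ^ (1 / 2 : ℝ) = H at hAA
  rw [← hAA, mul_assoc H, mul_assoc H, trace_mul_comm H]
  simp only [mul_assoc]

lemma re_trace_geomMean_le (hA : A.PosDef) (hB : B.PosDef) {t : ℝ} (ht : t ∈ Set.Icc (0 : ℝ) 1) :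
    (geomMean t A B).trace.re ≤ (A ^ (1 - t) * B ^ t).trace.re := by
  have h := re_trace_rpow_mul_rpow_le hA (posDef_conj hA hB (-(1 / 2))) le_rfl ht
  rw [rpow_half_conj_rpow_neg_half_conj hA, zero_add, rpow_one' hA] at h
  rwa [geomMean, trace_mul_comm, ← mul_assoc, rpow_half_mul_rpow_half hA]

lemma re_trace_mul_rpow_le (hA : A.PosDef) (hB : B.PosDef) {t : ℝ}
    (ht : t ∈ Set.Icc (0 : ℝ) 1) :
    (A * A * (A ^ (-(1 / 2) : ℝ) * B * A ^ (-(1 / 2) : ℝ)) ^ t).trace.re ≤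
      (A ^ (2 - t) * B ^ t).trace.re := by
  have h := re_trace_rpow_mul_rpow_le hA (posDef_conj hA hB (-(1 / 2))) zero_le_one ht
  rwa [rpow_half_conj_rpow_neg_half_conj hA, ← rpow_mul_rpow hA 1 1, rpow_one' hA,
    one_add_one_eq_two] at h

lemma re_trace_mul_geomMean_le (hA : A.PosDef) (hB : B.PosDef) {t : ℝ}
    (ht : t ∈ Set.Icc (0 : ℝ) 1) :
    (A * geomMean t A B).trace.re ≤ (A ^ (2 - t) * B ^ t).trace.re := by
  refine le_trans (le_of_eq ?_) (re_trace_mul_rpow_le hA hB ht)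
  have hcomm : A ^ (1 / 2 : ℝ) * (A * A ^ (1 / 2 : ℝ)) = A * A := by
    conv_rhs => rw [← rpow_half_mul_rpow_half hA]
    conv_lhs => enter [2, 1]; rw [← rpow_half_mul_rpow_half hA]
    simp only [mul_assoc]
  rw [geomMean, ← mul_assoc, trace_mul_comm, ← mul_assoc, ← mul_assoc, mul_assoc _ A, hcomm]

lemma re_trace_mul_geomMean_le' (hA : A.PosDef) (hB : B.PosDef) {t : ℝ}
    (ht : t ∈ Set.Icc (0 : ℝ) 1) :
    (B * geomMean t A B).trace.re ≤ (B ^ (1 + t) * A ^ (1 - t)).trace.re := by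
  rw [geomMean_comm hA hB]
  have := re_trace_mul_geomMean_le hB hA (t := 1 - t) ⟨by linarith [ht.2], by linarith [ht.1]⟩
  rwa [show 2 - (1 - t) = 1 + t by ring] at this

/-- With `C = A^{-1/2} B A^{-1/2}`, `2 c^t d^t ≤ c^{2t} + d^{2t}` on eigenvalues of `C` gives `Tr
C^t A C^t A ≤ Tr C^{2t} A²`. The main inequality then applies with exponent `2t`, whence `t ≤ 1/2`;
larger `t` follows by exchanging `A` and `B`. -/
lemma re_trace_geomMean_mul_self_le_of_le_half (hA : A.PosDef) (hB : B.PosDef) {t : ℝ}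
    (ht : t ∈ Set.Icc (0 : ℝ) (1 / 2)) :
    (geomMean t A B * geomMean t A B).trace.re ≤ (A ^ (2 - 2 * t) * B ^ (2 * t)).trace.re := by
  refine le_trans ?_ (re_trace_mul_rpow_le hA hB (t := 2 * t)
    ⟨by linarith [ht.1], by linarith [ht.2]⟩)
  have hC := posDef_conj hA hB (-(1 / 2))
  rw [trace_geomMean_mul_geomMean hA]
  have h := re_trace_cfc_le_of_symm hC.1 hA.1 (f := fun x => x ^ t) (g := fun x => x ^ t)
    (f' := fun x => x ^ (2 * t)) (g' := fun _ => 1) fun i j => by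
      rw [mul_comm 2 t, Real.rpow_mul (hC.eigenvalues_pos i).le,
        Real.rpow_mul (hC.eigenvalues_pos j).le, Real.rpow_two, Real.rpow_two]
      nlinarith [sq_nonneg (hC.1.eigenvalues i ^ t - hC.1.eigenvalues j ^ t)]
  rw [← rpow_eq_cfc hC, ← rpow_eq_cfc hC, cfc_one_eq_one hC.1, mul_one] at h
  rwa [trace_mul_comm (A * A), ← mul_assoc]

lemma re_trace_geomMean_mul_self_le (hA : A.PosDef) (hB : B.PosDef) {t : ℝ}
    (ht : t ∈ Set.Icc (0 : ℝ) 1) :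
    (geomMean t A B * geomMean t A B).trace.re ≤ (A ^ (2 - 2 * t) * B ^ (2 * t)).trace.re := by
  rcases le_total t (1 / 2) with h | h
  · exact re_trace_geomMean_mul_self_le_of_le_half hA hB ⟨ht.1, h⟩
  · have := re_trace_geomMean_mul_self_le_of_le_half hB hA (t := 1 - t)
      ⟨by linarith [ht.2], by linarith⟩
    rwa [← geomMean_comm hA hB, trace_mul_comm (B ^ _), show 2 - 2 * (1 - t) = 2 * t by ring,
      show 2 * (1 - t) = 2 - 2 * t by ring] at this

lemma re_trace_geomMean_mul_geomMean_le (hA : A.PosDef) (hB : B.PosDef) {t : ℝ}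
    (ht : t ∈ Set.Icc (0 : ℝ) 1) :
    (geomMean t A B * geomMean (1 - t) A B).trace.re ≤ (A * B).trace.re := by
  have hC := posDef_conj hA hB (-(1 / 2))
  rw [trace_geomMean_mul_geomMean hA]
  have h := re_trace_cfc_le_of_symm hC.1 hA.1 (f := fun x => x ^ t) (g := fun x => x ^ (1 - t))
    (f' := fun x => x ^ (1 : ℝ)) (g' := fun _ => 1) fun i j => by
      have hi := (hC.eigenvalues_pos i).le
      have hj := (hC.eigenvalues_pos j).le
      -- The two weighted AM-GM bounds add up to `c^t d^{1-t} + d^t c^{1-t} ≤ c + d`.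
      have h1 := Real.geom_mean_le_arith_mean2_weighted ht.1 (sub_nonneg.2 ht.2) hi hj (by ring)
      have h2 := Real.geom_mean_le_arith_mean2_weighted ht.1 (sub_nonneg.2 ht.2) hj hi (by ring)
      simp only [Real.rpow_one, mul_one]
      linarith
  rw [← rpow_eq_cfc hC, ← rpow_eq_cfc hC, ← rpow_eq_cfc hC, cfc_one_eq_one hC.1, mul_one,
    rpow_one' hC] at h
  refine h.trans (le_of_eq ?_)
  conv_rhs => rw [← rpow_half_conj_rpow_neg_half_conj hA B]
  generalize A ^ (-(1 / 2) : ℝ) * B * A ^ (-(1 / 2) : ℝ) = C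
  have hAA := rpow_half_mul_rpow_half hA
  generalize A ^ (1 / 2 : ℝ) = H at hAA
  rw [← hAA, show C * (H * H) * (H * H) = (C * H) * (H * H * H) by simp only [mul_assoc],
    trace_mul_comm]
  simp only [mul_assoc]

/-! ### The trace and Frobenius norms. -/

lemma re_trace_conjTranspose {κ : Type*} [Fintype κ] (X : Matrix κ κ ℂ) :
    Xᴴ.trace.re = X.trace.re := by
  rw [trace_conjTranspose, Complex.star_def, Complex.conj_re]

lemma schattenNorm_one (X : Matrix ι ι ℂ) : schattenNorm 1 X = (CFC.abs X).trace.re := by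
  rw [schattenNorm, CFC.rpow_one _ (CFC.abs_nonneg X), div_one, Real.rpow_one]

lemma schattenNorm_two (X : Matrix ι ι ℂ) :
    schattenNorm 2 X = √((Xᴴ * X).trace.re) := by
  have h : CFC.abs X ^ (2 : ℝ) = Xᴴ * X := by
    have := CFC.rpow_natCast (CFC.abs X) 2 (CFC.abs_nonneg X)
    rw [Nat.cast_ofNat] at this
    rw [this, sq, CFC.abs_mul_abs, star_eq_conjTranspose]
  rw [schattenNorm, h, Real.sqrt_eq_rpow]

/-- In an eigenbasis of `|X|`, the `i`-th column of `X` has Euclidean norm equal to the `i`-th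
eigenvalue of `|X|`, because `XᴴX = |X|²`; this norm bounds the diagonal entry. -/
lemma re_trace_le_schattenNorm_one (X : Matrix ι ι ℂ) : X.trace.re ≤ schattenNorm 1 X := by
  rw [schattenNorm_one]
  have hP : (CFC.abs X).PosSemidef := (CFC.abs_nonneg X).posSemidef
  have hsq : CFC.abs X * CFC.abs X = Xᴴ * X := CFC.abs_mul_abs X
  generalize CFC.abs X = P at hP hsq
  have hid : cfc (fun x : ℝ => x) P = P := cfc_id' ℝ P hP.1
  set Y := mixedMatrix hP.1 hP.1 X with hY
  have hYY : ∀ i, (Yᴴ * Y) i i = ((hP.1.eigenvalues i ^ 2 : ℝ) : ℂ) := fun i => by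
    have h1 : Yᴴ * Y = mixedMatrix hP.1 hP.1 (Xᴴ * X) := by
      simp only [hY, mixedMatrix, conjTranspose_mul, conjTranspose_conjTranspose, mul_assoc]
      congr 2
      rw [← mul_assoc, eigenvectorUnitary_mul_conjTranspose, one_mul]
    have h2 : mixedMatrix hP.1 hP.1 (P * P) i i =
        hP.1.eigenvalues i * (hP.1.eigenvalues i * mixedMatrix hP.1 hP.1 1 i i) := by
      have hPP : P * P = cfc (fun x : ℝ => x) P * (cfc (fun x : ℝ => x) P * 1) := by
        rw [hid, mul_one]
      rw [hPP, mixedMatrix_cfc_mul, mixedMatrix_cfc_mul]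
    have h3 : mixedMatrix hP.1 hP.1 (1 : Matrix ι ι ℂ) = 1 := by
      rw [mixedMatrix, mul_one, eigenvectorUnitary_conjTranspose_mul]
    rw [h1, ← hsq, h2, h3, one_apply_eq, mul_one, sq, Complex.ofReal_mul]
  have hXY : Y.trace = X.trace := by
    rw [hY, mixedMatrix, mul_assoc, trace_mul_comm, mul_assoc,
      eigenvectorUnitary_mul_conjTranspose, mul_one]
  rw [← hXY, hP.1.trace_eq_sum_eigenvalues, trace, Complex.re_sum, Complex.re_sum]
  refine sum_le_sum fun i _ => ?_
  rw [diag_apply]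
  refine le_trans (Complex.re_le_norm _) (abs_le_of_sq_le_sq' ?_ (hP.eigenvalues_nonneg i)).2
  have h := congr_arg Complex.re (hYY i)
  rw [mul_apply, Complex.re_sum, Complex.ofReal_re] at h
  rw [← h, ← Complex.normSq_eq_norm_sq]
  refine le_trans (le_of_eq ?_) (single_le_sum (f := fun k => (Yᴴ i k * Y k i).re)
    (fun k _ => ?_) (mem_univ i))
  · simp [Complex.normSq_apply]
  · simp only [conjTranspose_apply, Complex.star_def, Complex.mul_re, Complex.conj_re,
      Complex.conj_im]
    nlinarith [mul_self_nonneg (Y k i).re, mul_self_nonneg (Y k i).im]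

lemma schattenNorm_one_of_posSemidef (hX : X.PosSemidef) : schattenNorm 1 X = X.trace.re := by
  rw [schattenNorm_one, CFC.abs_of_nonneg X hX.nonneg]

/-! ### Comparison of the Heron-type sums. -/

lemma posSemidef_heron (hA : A.PosDef) (hB : B.PosDef) {r : ℝ} (hr : 0 ≤ r) (t : ℝ) :
    (A + B + r • (geomMean t A B + geomMean (1 - t) A B)).PosSemidef :=
  (hA.posSemidef.add hB.posSemidef).add (((geomMean_posDef hA hB t).posSemidef.add
    (geomMean_posDef hA hB (1 - t)).posSemidef).smul hr)

lemma re_trace_conjTranspose_mul_self_add_smul (hM : M.IsHermitian) (N : Matrix ι ι ℂ) (r : ℝ) :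
    ((M + r • N)ᴴ * (M + r • N)).trace.re =
      (M * M).trace.re + 2 * r * (M * N).trace.re + r ^ 2 * (Nᴴ * N).trace.re := by
  have h : (Nᴴ * M).trace.re = (M * N).trace.re := by
    rw [← re_trace_conjTranspose, conjTranspose_mul, conjTranspose_conjTranspose, hM.eq]
  rw [conjTranspose_add, hM.eq, conjTranspose_smul, star_trivial]
  simp only [add_mul, mul_add, smul_mul_assoc, mul_smul_comm, trace_add, trace_smul,
    Complex.add_re, Complex.smul_re, smul_eq_mul, h]
  ring

lemma re_trace_add_mul_geomMean_add_le (hA : A.PosDef) (hB : B.PosDef) {t : ℝ}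
    (ht : t ∈ Set.Icc (0 : ℝ) 1) :
    ((A + B) * (geomMean t A B + geomMean (1 - t) A B)).trace.re ≤
      ((A + B) * (A ^ t * B ^ (1 - t) + A ^ (1 - t) * B ^ t)).trace.re := by
  have ht' : 1 - t ∈ Set.Icc (0 : ℝ) 1 := ⟨by linarith [ht.2], by linarith [ht.1]⟩
  have eA : ∀ s u : ℝ, (A * (A ^ s * B ^ u)).trace = (A ^ (1 + s) * B ^ u).trace := fun s u => by
    have := rpow_mul_rpow hA 1 s
    rw [← this, rpow_one' hA, mul_assoc]
  have eB : ∀ s u : ℝ, (B * (A ^ s * B ^ u)).trace = (B ^ (1 + u) * A ^ s).trace := fun s u => by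
    have := rpow_mul_rpow hB u 1
    rw [trace_mul_comm, mul_assoc, trace_mul_comm, add_comm 1 u, ← this, rpow_one' hB]
  have h1 := re_trace_mul_geomMean_le hA hB ht
  have h2 := re_trace_mul_geomMean_le hA hB ht'
  have h3 := re_trace_mul_geomMean_le' hA hB ht
  have h4 := re_trace_mul_geomMean_le' hA hB ht'
  simp only [add_mul, mul_add, trace_add, Complex.add_re, eA, eB]
  rw [show 2 - (1 - t) = 1 + t by ring] at h2
  rw [show 1 - (1 - t) = t by ring] at h4
  rw [show 1 + (1 - t) = 2 - t by ring] at h4 ⊢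
  linarith

lemma re_trace_geomMean_add_sq_le (hA : A.PosDef) (hB : B.PosDef) {t : ℝ}
    (ht : t ∈ Set.Icc (0 : ℝ) 1) :
    ((geomMean t A B + geomMean (1 - t) A B)ᴴ *
        (geomMean t A B + geomMean (1 - t) A B)).trace.re ≤
      ((A ^ t * B ^ (1 - t) + A ^ (1 - t) * B ^ t)ᴴ *
        (A ^ t * B ^ (1 - t) + A ^ (1 - t) * B ^ t)).trace.re := by
  have ht' : 1 - t ∈ Set.Icc (0 : ℝ) 1 := ⟨by linarith [ht.2], by linarith [ht.1]⟩
  have e : ∀ a b c d : ℝ, (B ^ a * A ^ b * (A ^ c * B ^ d)).trace =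
      (A ^ (b + c) * B ^ (d + a)).trace := fun a b c d => by
    rw [← rpow_mul_rpow hA, ← rpow_mul_rpow hB, mul_assoc, trace_mul_comm]
    simp only [mul_assoc]
  have h1 := re_trace_geomMean_mul_self_le hA hB ht
  have h2 := re_trace_geomMean_mul_self_le hA hB ht'
  have h3 := re_trace_geomMean_mul_geomMean_le hA hB ht
  simp only [conjTranspose_add, conjTranspose_mul, (isHermitian_rpow A _).eq,
    (isHermitian_rpow B _).eq, (geomMean_posDef hA hB _).1.eq, add_mul, mul_add, trace_add,
    Complex.add_re, e, trace_mul_comm (geomMean (1 - t) A B) (geomMean t A B)]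
  rw [show 2 - 2 * (1 - t) = t + t by ring, show 2 * (1 - t) = 1 - t + (1 - t) by ring] at h2
  rw [show 2 - 2 * t = 1 - t + (1 - t) by ring, show 2 * t = t + t by ring] at h1
  rw [show 1 - t + t = 1 by ring, show t + (1 - t) = 1 by ring, rpow_one' hA, rpow_one' hB]
  linarith

end HeronMean

open HeronMean in
theorem theorem1p1 (n : ℕ) (A B : Matrix (Fin n) (Fin n) ℂ) (hA : A.PosDef) (hB : B.PosDef)
    (r t : ℝ) (hr : 0 ≤ r) (ht : t ∈ Set.Icc (0 : ℝ) 1) (p : ℝ) (hp : p = 1 ∨ p = 2) :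
    HeronMean.schattenNorm p
        (A + B + r • (HeronMean.geomMean t A B + HeronMean.geomMean (1 - t) A B)) ≤
      HeronMean.schattenNorm p
        (A + B + r • (A ^ t * B ^ (1 - t) + A ^ (1 - t) * B ^ t)) := by
  have ht' : 1 - t ∈ Set.Icc (0 : ℝ) 1 := ⟨by linarith [ht.2], by linarith [ht.1]⟩
  rcases hp with rfl | rfl
  · rw [schattenNorm_one_of_posSemidef (posSemidef_heron hA hB hr t)]
    refine le_trans ?_ (re_trace_le_schattenNorm_one _)
    have h1 := re_trace_geomMean_le hA hB ht
    have h2 := re_trace_geomMean_le hA hB ht'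
    rw [sub_sub_cancel] at h2
    simp only [Matrix.trace_add, Matrix.trace_smul, Complex.add_re, Complex.smul_re, smul_eq_mul]
    have := mul_le_mul_of_nonneg_left (add_le_add h1 h2) hr
    linarith
  · have hM : (A + B).IsHermitian := hA.1.add hB.1
    rw [schattenNorm_two, schattenNorm_two, re_trace_conjTranspose_mul_self_add_smul hM,
      re_trace_conjTranspose_mul_self_add_smul hM]
    refine Real.sqrt_le_sqrt (add_le_add (add_le_add le_rfl ?_) ?_)
    · exact mul_le_mul_of_nonneg_left (re_trace_add_mul_geomMean_add_le hA hB ht) (by positivity)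
    · exact mul_le_mul_of_nonneg_left (re_trace_geomMean_add_sq_le hA hB ht) (by positivity)
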